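/- **Conventions.** Identify $\mathbb R^2$ with $\mathbb C$. A *circle* here means a circle of positive radius or a line. It is taken together with the closed disc, respectively one of the closed half-planes, that it bounds; circles are *externally tangent* if these closed regions touch at a point of the plane and have disjoint interiors (two lines are never externally tangent). Let $C_0$ be a circle of positive radius with center $c_0$, and let $C_1,C_2$ be circles, at most one of them a line, such that $C_0,C_1,C_2$ are pairwise externally tangent. For externally tangent circles $C,C'$, both externally tangent to $C_0$, let $s(C,C')$ be the *successor* of the triple $(C_0,C,C')$, i.e. the smaller of the two circles tangent to all three (the one in the bounded region enclosed by them). For $C$ externally tangent to $C_0$ let $v(C)=c-c_0$ if $C$ has center $c$, and let $v(C)$ be the unit vector pointing from $c_0$ to the point of tangency with $C_0$ if $C$ is a line; let $\ell^{1/2}(C)=\mathbb R\,v(C)^{1/2}$ be the real line through $0$ spanned by a complex square root of $v(C)$. Let $\mathcal C$ be the smallest set of circles containing $C_1,C_2$ and such that $s(C,C')\in\mathcal C$ for all tangent $C,C'\in\mathcal C$. Choose values $\alpha(C_1),\alpha(C_2)\in\mathbb R$ of the angles of $v(C_1),v(C_2)$ with the positive $x$-axis such that $|\alpha(C_1)-\alpha(C_2)|<\pi$,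 let $I$ be the closed interval with endpoints $\alpha(C_1),\alpha(C_2)$ (in either order), and for $C\in\mathcal C$ let $\alpha(C)\in I$ be the value in $I$ of the angle of $v(C)$ with the positive $x$-axis. A continuous curve $\gamma:I\to\mathbb R^2$ is an *Apollonian curve* associated to $(C_0,C_1,C_2)$ if $$\gamma(\alpha(C))-\gamma(\alpha(C'))\in \ell^{1/2}(s(C,C'))\qquad\text{for all tangent } C,C'\in\mathcal C .$$ A line $L$ is a *tangent line* of a set $\Gamma\subset\mathbb R^2$ at an accumulation point $p\in\Gamma$ of $\Gamma$ if $p\in L$ and $\operatorname{dist}(q,L)=o(|q-p|)$ as $q\to p$ within $\Gamma$. **Theorem.** Let $\gamma:I\to\mathbb R^2$ be a non-constant Apollonian curve associated to $(C_0,C_1,C_2)$. Then for every $\alpha\in I$ (endpoints included) the image of $\gamma$ has a unique tangent line at $\gamma(\alpha)$, namely the line through $\gamma(\alpha)$ at angle $\alpha/2$ to the positive $x$-axis. In particular, $\gamma$ is a convex curve: it is injective, and its image lies, for each of its tangent lines, in one of the two closed half-planes bounded by that line. -/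

import Mathlib

/-- A circle of positive radius, or a line, in the plane `ℂ`, together with the closed disc
(resp. closed half-plane) that it bounds.  `line n d` is the line `⟪n, z⟫ = d`, with unit normal
`n`, bounding the closed half-plane `d ≤ ⟪n, z⟫`. -/
inductive GenCircle : Type where
  | circle (c : ℂ) (r : ℝ) (hr : 0 < r) : GenCircle
  | line (n : ℂ) (d : ℝ) (hn : ‖n‖ = 1) : GenCircle

namespace GenCircle

/-- External tangency: the two closed discs (or half-planes) touch and have disjoint interiors.
Two lines have no finite point of tangency and are not counted as externally tangent. -/
noncomputable def ExtTangent : GenCircle → GenCircle → Prop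
  | circle c r _, circle c' r' _ => dist c c' = r + r'
  | circle c r _, line n d _ => inner ℝ n c + r = d
  | line n d _, circle c r _ => inner ℝ n c + r = d
  | line _ _ _, line _ _ _ => False

/-- The curvature `1 / r` of a circle of radius `r`; lines have curvature `0`. -/
noncomputable def curvature : GenCircle → ℝ
  | circle _ r _ => 1 / r
  | line _ _ _ => 0

/-- `S` is the successor of the triple `A, B, C` of pairwise externally tangent circles: the
smaller of the two circles tangent to all three. -/
def IsSuccessor (A B C S : GenCircle) : Prop :=
  (S.ExtTangent A ∧ S.ExtTangent B ∧ S.ExtTangent C) ∧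
    ∀ T : GenCircle, T.ExtTangent A → T.ExtTangent B → T.ExtTangent C →
      T.curvature ≤ S.curvature

/-- The vector `v(C) = c - c₀` from `c₀` to the centre `c` of `C`.  For a line it is the unit
normal pointing into its half-plane; if the line is tangent to a circle with centre `c₀` on the
other side, this is the direction from `c₀` to the point of tangency (as it is for a circle). -/
def vec (c₀ : ℂ) : GenCircle → ℂ
  | circle c _ _ => c - c₀
  | line n _ _ => n

/-- The family `𝒞` of `(C₀, C₁, C₂)`: the smallest set of circles that contains `C₁`, `C₂` and,
with any two tangent circles `C`, `C'`, the successor of the triple `(C₀, C, C')`. -/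
inductive Family (C₀ C₁ C₂ : GenCircle) : GenCircle → Prop where
  | left : Family C₀ C₁ C₂ C₁
  | right : Family C₀ C₁ C₂ C₂
  | succ (C C' S : GenCircle) : Family C₀ C₁ C₂ C → Family C₀ C₁ C₂ C' →
      C.ExtTangent C' → IsSuccessor C₀ C C' S → Family C₀ C₁ C₂ S

end GenCircle

/-- `t` is an angle (one of the values modulo `2π`) of the vector `v` with the positive
`x`-axis. -/
def IsAngleOf (t : ℝ) (v : ℂ) : Prop :=
  v ≠ 0 ∧ v = (‖v‖ : ℂ) * Complex.exp ((t : ℂ) * Complex.I)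

/-- The real line spanned by a complex square root of `v`. -/
noncomputable def sqrtLine (v : ℂ) : Submodule ℝ ℂ :=
  Submodule.span ℝ {w : ℂ | w ^ 2 = v}

/-- `γ`, restricted to the interval with endpoints `a₁` and `a₂`, is an Apollonian curve
associated to `(C₀, C₁, C₂)`, where `C₀` is the circle with centre `c₀` and radius `r₀`. Here `a₁`
and `a₂` are to be the angles of `v(C₁)` and `v(C₂)`, and the angle `α(C)` of a circle
of the family is its value in this interval. -/
structure IsApollonianCurve (c₀ : ℂ) (r₀ : ℝ) (hr₀ : 0 < r₀) (C₁ C₂ : GenCircle) (a₁ a₂ : ℝ)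
    (γ : ℝ → ℂ) : Prop where
  continuousOn : ContinuousOn γ (Set.uIcc a₁ a₂)
  sub_mem : ∀ C C' S : GenCircle,
    GenCircle.Family (.circle c₀ r₀ hr₀) C₁ C₂ C → GenCircle.Family (.circle c₀ r₀ hr₀) C₁ C₂ C' →
    C.ExtTangent C' → GenCircle.IsSuccessor (.circle c₀ r₀ hr₀) C C' S →
    ∀ t ∈ Set.uIcc a₁ a₂, ∀ t' ∈ Set.uIcc a₁ a₂,
      IsAngleOf t (C.vec c₀) → IsAngleOf t' (C'.vec c₀) →
        γ t - γ t' ∈ sqrtLine (S.vec c₀)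

/-- `L` is a tangent line of the set `Γ` at `p`: a line through `p`, where `p` is an accumulation
point of `Γ`, such that the angle between `L` and the secants from `p` to points `q ∈ Γ` tends to
zero as `q → p`, i.e. the distance from `q` to `L` is `o(|q - p|)`. -/
def IsTangentLine (Γ : Set ℂ) (p : ℂ) (L : AffineSubspace ℝ ℂ) : Prop :=
  p ∈ L ∧ Module.finrank ℝ L.direction = 1 ∧ p ∈ Γ ∧ AccPt p (Filter.principal Γ) ∧
    Asymptotics.IsLittleO (nhdsWithin p Γ) (fun q : ℂ => Metric.infDist q (L : Set ℂ))
      (fun q : ℂ => q - p)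

/-- The line through `p` at angle `θ` to the positive `x`-axis. -/
noncomputable def lineAtAngle (p : ℂ) (θ : ℝ) : AffineSubspace ℝ ℂ :=
  AffineSubspace.mk' p (Submodule.span ℝ {Complex.exp ((θ : ℂ) * Complex.I)})

/-- `γ` is a convex curve on the parameter set `I`: a simple curve whose image has a tangent
line at each of its points and lies on one side of each tangent line (in a closed half-plane
bounded by that line). -/
def IsConvexCurve (γ : ℝ → ℂ) (I : Set ℝ) : Prop :=
  ContinuousOn γ I ∧ Set.InjOn γ I ∧
    ∀ t ∈ I, (∃ L, IsTangentLine (γ '' I) (γ t) L) ∧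
      ∀ L, IsTangentLine (γ '' I) (γ t) L →
        ∃ n : ℂ, n ≠ 0 ∧ (∀ z ∈ L, inner ℝ n (z - γ t) = 0) ∧
          ∀ z ∈ γ '' I, 0 ≤ inner ℝ n (z - γ t)

/-! Replace each circle tangent to `C₀` by a spinor: a complex square root of `v(C)`, rescaled so
that its squared length is the curvature of `C` plus `1 / r₀`. External tangency of two such circles
then forces the cross product of their spinors to be `± 1 / r₀`, with a converse once one of the two
has positive radius (`extTangent_of_cross_sq`), and at a nonobtuse angle the successor has the sum
of the two spinors (`exists_isSuccessor`). Starting from spinors `u`, `v` of `C₁`, `C₂`, the family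
therefore contains circles with spinors `a * u + b * v`, arranged as in the Stern–Brocot tree; these
suffice for the proof.

The spinor `a * u + b * v` has the direction of the point `u + τ * (v - u)` of a segment, with `τ =
b / (a + b)`. Parametrised by `τ ∈ [0, 1]`, an Apollonian curve has all its chords over Stern–Brocot
neighbours parallel to the mediant spinor. A chord is the sum of the chords over the two halves, and
linear independence forces both halves to have a third of its coefficient (`exists_pos_chord`). So
all coefficients have one sign, and in the basis `u`, `v - u` the curve is a graph whose slope over
a neighbour interval `[s, t]` lies in `[s, t]`. This passes to all intervals by transitivity and
continuity (`rel_of_le`, `exists_slope_bounds`), and yields injectivity, the tangents and the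
supporting half-planes (`tangent_and_convex_of_chords`). -/

open Set Filter Topology

/-! ### Stern–Brocot neighbours and their Farey fractions. -/

/-- Neighbouring pairs `(a, b)`, `(c, d)` of the Stern–Brocot tree. -/
inductive SternPair : ℕ → ℕ → ℕ → ℕ → Prop
  | base : SternPair 1 0 0 1
  | left {a b c d : ℕ} : SternPair a b c d → SternPair a b (a + c) (b + d)
  | right {a b c d : ℕ} : SternPair a b c d → SternPair (a + c) (b + d) c d

/-- The Farey fraction `b / (a + b)`. -/
noncomputable def fareyPoint (a b : ℕ) : ℝ := b / (a + b)

namespace SternPair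

variable {a b c d : ℕ}

theorem det (h : SternPair a b c d) : a * d = b * c + 1 := by
  induction h with
  | base => rfl
  | left _ ih => linarith [mul_comm ‹ℕ› ‹ℕ›]
  | right _ ih => linarith [mul_comm ‹ℕ› ‹ℕ›]

theorem det_real (h : SternPair a b c d) : (a : ℝ) * d - b * c = 1 := by
  have := h.det
  have h' : (a : ℝ) * d = b * c + 1 := by exact_mod_cast this
  linarith

theorem pos_left (h : SternPair a b c d) : 1 ≤ (a : ℝ) + b := by
  have := h.det
  have : 1 ≤ a + b := by
    rcases Nat.eq_zero_or_pos a with rfl | ha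
    · simp at this
    · omega
  exact_mod_cast this

theorem pos_right (h : SternPair a b c d) : 1 ≤ (c : ℝ) + d := by
  have := h.det
  have : 1 ≤ c + d := by
    rcases Nat.eq_zero_or_pos d with rfl | ha
    · simp at this
    · omega
  exact_mod_cast this

theorem fareyPoint_sub (h : SternPair a b c d) :
    fareyPoint c d - fareyPoint a b = 1 / (((a : ℝ) + b) * (c + d)) := by
  have h1 := h.pos_left
  have h2 := h.pos_right
  have h3 := h.det_real
  unfold fareyPoint
  rw [div_sub_div _ _ (by positivity) (by positivity), div_eq_div_iff (by positivity) (by positivity)]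
  linear_combination ((a : ℝ) + b) * (c + d) * h3

theorem fareyPoint_lt (h : SternPair a b c d) : fareyPoint a b < fareyPoint c d := by
  have h1 := h.pos_left
  have h2 := h.pos_right
  have := h.fareyPoint_sub
  have h3 : 0 < 1 / (((a : ℝ) + b) * (c + d)) := by positivity
  linarith

/-- For `x, y ≥ 1` one has `x * y ≥ x + y - 1`. The weaker bound is preferred because the sum of the
entries grows by at least one at each mediant, which suits induction on the depth. -/
theorem fareyPoint_sub_le (h : SternPair a b c d) :
    fareyPoint c d - fareyPoint a b ≤ 1 / ((a : ℝ) + b + c + d - 1) := by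
  have h1 := h.pos_left
  have h2 := h.pos_right
  rw [h.fareyPoint_sub]
  apply one_div_le_one_div_of_le <;> nlinarith

theorem fareyPoint_mem (h : SternPair a b c d) : 0 ≤ fareyPoint a b ∧ fareyPoint c d ≤ 1 := by
  have h2 := h.pos_right
  refine ⟨by unfold fareyPoint; positivity, ?_⟩
  unfold fareyPoint
  rw [div_le_one (by positivity)]
  linarith [(Nat.cast_nonneg c : (0 : ℝ) ≤ c)]

/-! ### From neighbours to arbitrary points of the unit interval. -/

/-- A reflexive transitive relation that holds for all neighbours holds, between any two points of
a Stern–Brocot interval, up to a small perturbation of these points. -/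
theorem exists_approx {R : ℝ → ℝ → Prop} (hrefl : ∀ x, R x x)
    (htrans : ∀ x y z, R x y → R y z → R x z)
    (hR : ∀ {a b c d}, SternPair a b c d → R (fareyPoint a b) (fareyPoint c d)) (N : ℕ) :
    ∀ {a b c d}, SternPair a b c d →
      ∀ s ∈ Icc (fareyPoint a b) (fareyPoint c d), ∀ t ∈ Icc (fareyPoint a b) (fareyPoint c d),
        s ≤ t → ∃ s' ∈ Icc (fareyPoint a b) (fareyPoint c d),
          ∃ t' ∈ Icc (fareyPoint a b) (fareyPoint c d),
            |s' - s| ≤ 1 / ((a : ℝ) + b + c + d + N - 1) ∧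
            |t' - t| ≤ 1 / ((a : ℝ) + b + c + d + N - 1) ∧
            R (fareyPoint a b) s' ∧ R s' t' ∧ R t' (fareyPoint c d) := by
  induction N with
  | zero =>
    intro a b c d h s hs t ht hst
    have hl := h.fareyPoint_sub_le
    have hlt := h.fareyPoint_lt.le
    -- At depth zero the two ends of the interval serve as approximations.
    refine ⟨_, left_mem_Icc.2 hlt, _, right_mem_Icc.2 hlt, ?_, ?_, hrefl _, hR h, hrefl _⟩ <;>
    · rw [Nat.cast_zero, add_zero, abs_le]
      constructor <;> linarith [hs.1, hs.2, ht.1, ht.2]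
  | succ N ih =>
    intro a b c d h s hs t ht hst
    have h1 := h.pos_left
    have h2 := h.pos_right
    have hN : (0 : ℝ) ≤ N := Nat.cast_nonneg N
    set m := fareyPoint (a + c) (b + d) with hm
    have hlm : fareyPoint a b < m := h.left.fareyPoint_lt
    have hmr : m < fareyPoint c d := h.right.fareyPoint_lt
    have e1 : 1 / ((a : ℝ) + b + (a + c : ℕ) + (b + d : ℕ) + N - 1) ≤
        1 / ((a : ℝ) + b + c + d + (N + 1 : ℕ) - 1) := by
      push_cast
      apply one_div_le_one_div_of_le <;> linarith
    have e2 : 1 / (((a + c : ℕ) : ℝ) + (b + d : ℕ) + c + d + N - 1) ≤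
        1 / ((a : ℝ) + b + c + d + (N + 1 : ℕ) - 1) := by
      push_cast
      apply one_div_le_one_div_of_le <;> linarith
    rcases le_total t m with htm | htm
    · obtain ⟨s', hs', t', ht', hs1, ht1, r1, r2, r3⟩ :=
        ih h.left s ⟨hs.1, hst.trans htm⟩ t ⟨ht.1, htm⟩ hst
      exact ⟨s', ⟨hs'.1, hs'.2.trans hmr.le⟩, t', ⟨ht'.1, ht'.2.trans hmr.le⟩, hs1.trans e1,
        ht1.trans e1, r1, r2, htrans _ _ _ r3 (hR h.right)⟩
    rcases le_total m s with hsm | hsm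
    · obtain ⟨s', hs', t', ht', hs1, ht1, r1, r2, r3⟩ :=
        ih h.right s ⟨hsm, hs.2⟩ t ⟨htm, ht.2⟩ hst
      exact ⟨s', ⟨hlm.le.trans hs'.1, hs'.2⟩, t', ⟨hlm.le.trans ht'.1, ht'.2⟩, hs1.trans e2,
        ht1.trans e2, htrans _ _ _ (hR h.left) r1, r2, r3⟩
    -- The mediant separates `s` and `t`: chain `s'`, `m'`, `m`, `m''`, `t'`. The relations to the
    -- ends of the interval are part of the induction in order to pass through `m`.
    · obtain ⟨s', hs', m', hm', hs1, -, r1, r2, r3⟩ :=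
        ih h.left s ⟨hs.1, hsm⟩ m ⟨hlm.le, le_rfl⟩ hsm
      obtain ⟨m'', hm'', t', ht', -, ht1, q1, q2, q3⟩ :=
        ih h.right m ⟨le_rfl, hmr.le⟩ t ⟨htm, ht.2⟩ htm
      exact ⟨s', ⟨hs'.1, hs'.2.trans hmr.le⟩, t', ⟨hlm.le.trans ht'.1, ht'.2⟩, hs1.trans e1,
        ht1.trans e2, r1, htrans _ _ _ (htrans _ _ _ r2 r3) (htrans _ _ _ q1 q2), q3⟩

/-- A closed preorder that holds for all Stern–Brocot neighbours contains the order of `[0, 1]`. -/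
theorem rel_of_le {R : ℝ → ℝ → Prop} (hrefl : ∀ x, R x x)
    (htrans : ∀ x y z, R x y → R y z → R x z)
    (hclosed : ∀ (x y : ℕ → ℝ) (s t : ℝ), (∀ n, x n ∈ Icc (0 : ℝ) 1) → (∀ n, y n ∈ Icc (0 : ℝ) 1) →
      s ∈ Icc (0 : ℝ) 1 → t ∈ Icc (0 : ℝ) 1 → Tendsto x atTop (𝓝 s) → Tendsto y atTop (𝓝 t) →
      (∀ n, R (x n) (y n)) → R s t)
    (hR : ∀ {a b c d}, SternPair a b c d → R (fareyPoint a b) (fareyPoint c d))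
    {s t : ℝ} (hs : 0 ≤ s) (hst : s ≤ t) (ht : t ≤ 1) : R s t := by
  have h0 : fareyPoint 1 0 = 0 := by simp [fareyPoint]
  have h1 : fareyPoint 0 1 = 1 := by simp [fareyPoint]
  have key : ∀ N : ℕ, ∃ s' t', s' ∈ Icc (0 : ℝ) 1 ∧ t' ∈ Icc (0 : ℝ) 1 ∧
      |s' - s| ≤ 1 / ((N : ℝ) + 1) ∧ |t' - t| ≤ 1 / ((N : ℝ) + 1) ∧ R s' t' := by
    intro N
    obtain ⟨s', hs', t', ht', k1, k2, -, k3, -⟩ := exists_approx hrefl htrans hR N base s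
      (by rw [h0, h1]; exact ⟨hs, hst.trans ht⟩) t (by rw [h0, h1]; exact ⟨hs.trans hst, ht⟩) hst
    rw [h0, h1] at hs' ht'
    have e : ((1 : ℕ) : ℝ) + (0 : ℕ) + (0 : ℕ) + (1 : ℕ) + N - 1 = N + 1 := by push_cast; ring
    rw [e] at k1 k2
    exact ⟨s', t', hs', ht', k1, k2, k3⟩
  choose x y hx hy hxs hyt hxy using key
  have hlim : ∀ {z : ℕ → ℝ} {l : ℝ}, (∀ n, |z n - l| ≤ 1 / ((n : ℝ) + 1)) →
      Tendsto z atTop (𝓝 l) := fun hz => by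
    rw [tendsto_iff_dist_tendsto_zero]
    exact squeeze_zero (fun _ => dist_nonneg) (fun n => by rw [Real.dist_eq]; exact hz n)
      tendsto_one_div_add_atTop_nhds_zero_nat
  exact hclosed x y s t hx hy ⟨hs, hst.trans ht⟩ ⟨hs.trans hst, ht⟩ (hlim hxs) (hlim hyt) hxy

/-- Between any two points of `[0, 1]` there are two Stern–Brocot neighbours. -/
theorem exists_between {s t : ℝ} (hs : 0 ≤ s) (hst : s < t) (ht : t ≤ 1) :
    ∃ a b c d, SternPair a b c d ∧ s ≤ fareyPoint a b ∧ fareyPoint c d ≤ t := by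
  have key : ∀ N : ℕ, ∃ a b c d, SternPair a b c d ∧ (N : ℝ) + 2 ≤ a + b + c + d ∧
      (s + t) / 2 ∈ Icc (fareyPoint a b) (fareyPoint c d) := by
    intro N
    induction N with
    | zero =>
      refine ⟨_, _, _, _, base, by norm_num, ?_⟩
      simp only [fareyPoint]
      constructor <;> norm_num <;> linarith
    | succ N ih =>
      obtain ⟨a, b, c, d, h, hN, hm⟩ := ih
      have h1 := h.pos_left
      have h2 := h.pos_right
      rcases le_total ((s + t) / 2) (fareyPoint (a + c) (b + d)) with hle | hle
      · exact ⟨_, _, _, _, h.left, by push_cast; linarith, hm.1, hle⟩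
      · exact ⟨_, _, _, _, h.right, by push_cast; linarith, hle, hm.2⟩
  obtain ⟨N, hN⟩ := exists_nat_one_div_lt (show 0 < (t - s) / 2 by linarith)
  obtain ⟨a, b, c, d, h, hab, hm⟩ := key N
  have hle := h.fareyPoint_sub_le
  have : 1 / ((a : ℝ) + b + c + d - 1) ≤ 1 / ((N : ℝ) + 1) :=
    one_div_le_one_div_of_le (by positivity) (by linarith)
  exact ⟨a, b, c, d, h, by linarith [hm.2], by linarith [hm.1]⟩

end SternPair

/-! ### Curves whose chords are parallel to mediants, in coordinates. -/

namespace SternPair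

/-- If all chords of `(X, Y)` over Stern–Brocot neighbours have the direction of the mediant, they
are positive multiples of it, up to a common factor. -/
theorem exists_pos_chord {X Y : ℝ → ℝ}
    (hXY : ∀ {a b c d}, SternPair a b c d → ∃ k : ℝ,
      X (fareyPoint c d) - X (fareyPoint a b) = k * (a + b + c + d) ∧
      Y (fareyPoint c d) - Y (fareyPoint a b) = k * (b + d)) :
    ∃ κ : ℝ, ∀ {a b c d}, SternPair a b c d → ∃ m : ℝ, 0 < m ∧
      X (fareyPoint c d) - X (fareyPoint a b) = m * κ * (a + b + c + d) ∧
      Y (fareyPoint c d) - Y (fareyPoint a b) = m * κ * (b + d) := by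
  obtain ⟨κ, hκ⟩ := hXY base
  refine ⟨κ, fun {a b c d} h => ?_⟩
  have aux : ∀ {a b c d} (h : SternPair a b c d) (k : ℝ),
      X (fareyPoint c d) - X (fareyPoint a b) = k * (a + b + c + d) →
      Y (fareyPoint c d) - Y (fareyPoint a b) = k * (b + d) →
      (X (fareyPoint (a + c) (b + d)) - X (fareyPoint a b) = k / 3 * (2 * (a + b) + (c + d)) ∧
        Y (fareyPoint (a + c) (b + d)) - Y (fareyPoint a b) = k / 3 * (2 * b + d)) ∧
      (X (fareyPoint c d) - X (fareyPoint (a + c) (b + d)) = k / 3 * ((a + b) + 2 * (c + d)) ∧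
        Y (fareyPoint c d) - Y (fareyPoint (a + c) (b + d)) = k / 3 * (b + 2 * d)) := by
    intro a b c d h k hX hY
    obtain ⟨k₁, hX1, hY1⟩ := hXY h.left
    obtain ⟨k₂, hX2, hY2⟩ := hXY h.right
    have hdet := h.det_real
    push_cast at hX1 hY1 hX2 hY2
    -- The two half chords add up to the whole chord. As the pair has determinant one, the
    -- coefficients can be compared: `2 * k₁ + k₂ = k = k₁ + 2 * k₂`.
    have e1 : (2 * k₁ + k₂ - k) * (a + b) + (k₁ + 2 * k₂ - k) * (c + d) = 0 := by linarith
    have e2 : (2 * k₁ + k₂ - k) * b + (k₁ + 2 * k₂ - k) * d = 0 := by linarith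
    have f1 : 2 * k₁ + k₂ - k = 0 := by
      linear_combination d * e1 - (c + d) * e2 - (2 * k₁ + k₂ - k) * hdet
    have f2 : k₁ + 2 * k₂ - k = 0 := by
      linear_combination (a + b) * e2 - b * e1 - (k₁ + 2 * k₂ - k) * hdet
    have g1 : k₁ = k / 3 := by linarith
    have g2 : k₂ = k / 3 := by linarith
    subst g1
    rw [g2] at hX2 hY2
    exact ⟨⟨by rw [hX1]; ring, by rw [hY1]; ring⟩, by rw [hX2]; ring, by rw [hY2]; ring⟩
  induction h with
  | base => exact ⟨1, one_pos, by rw [one_mul]; exact hκ.1, by rw [one_mul]; exact hκ.2⟩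
  | left h ih =>
    obtain ⟨m, hm, hX, hY⟩ := ih
    have := (aux h _ hX hY).1
    exact ⟨m / 3, by positivity, by rw [this.1]; push_cast; ring, by rw [this.2]; push_cast; ring⟩
  | right h ih =>
    obtain ⟨m, hm, hX, hY⟩ := ih
    have := (aux h _ hX hY).2
    exact ⟨m / 3, by positivity, by rw [this.1]; push_cast; ring, by rw [this.2]; push_cast; ring⟩

/-- A nonconstant continuous curve `(X, Y)` all of whose chords over Stern–Brocot neighbours have
the direction of the mediant has, up to orientation, strictly increasing `X` and slopes over
`[s, t]` between `s` and `t`. -/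
theorem exists_slope_bounds {X Y : ℝ → ℝ} (hX : ContinuousOn X (Icc 0 1))
    (hY : ContinuousOn Y (Icc 0 1))
    (hXY : ∀ {a b c d}, SternPair a b c d → ∃ k : ℝ,
      X (fareyPoint c d) - X (fareyPoint a b) = k * (a + b + c + d) ∧
      Y (fareyPoint c d) - Y (fareyPoint a b) = k * (b + d))
    (hne : ∃ s ∈ Icc (0 : ℝ) 1, ∃ t ∈ Icc (0 : ℝ) 1, X s ≠ X t ∨ Y s ≠ Y t) :
    ∃ κ : ℝ, κ ≠ 0 ∧ ∀ s t, 0 ≤ s → s < t → t ≤ 1 → 0 < κ * (X t - X s) ∧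
      s * (κ * (X t - X s)) ≤ κ * (Y t - Y s) ∧ κ * (Y t - Y s) ≤ t * (κ * (X t - X s)) := by
  obtain ⟨κ, hκ⟩ := exists_pos_chord hXY
  have hseq : ∀ {Z : ℝ → ℝ} {x : ℕ → ℝ} {s : ℝ}, ContinuousOn Z (Icc 0 1) → s ∈ Icc (0 : ℝ) 1 →
      (∀ n, x n ∈ Icc (0 : ℝ) 1) → Tendsto x atTop (𝓝 s) →
      Tendsto (fun n => Z (x n)) atTop (𝓝 (Z s)) := fun hZ hs hx hxs =>
    (hZ _ hs).tendsto.comp (tendsto_nhdsWithin_iff.2 ⟨hxs, Eventually.of_forall hx⟩)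
  -- If the common factor vanished, all neighbour chords would vanish and the curve would be
  -- constant.
  have hκ0 : κ ≠ 0 := by
    rintro rfl
    have hconst : ∀ s t, 0 ≤ s → s ≤ t → t ≤ 1 → X s = X t ∧ Y s = Y t := fun s t h0 hst h1 => by
      refine rel_of_le (R := fun s t => X s = X t ∧ Y s = Y t) (fun _ => ⟨rfl, rfl⟩)
        (fun _ _ _ h h' => ⟨h.1.trans h'.1, h.2.trans h'.2⟩) ?_ ?_ h0 hst h1
      · intro x y s t hx hy hs ht hxs hyt hR
        constructor
        · have := hseq hX ht hy hyt
          simp_rw [← fun n => (hR n).1] at this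
          exact tendsto_nhds_unique (hseq hX hs hx hxs) this
        · have := hseq hY ht hy hyt
          simp_rw [← fun n => (hR n).2] at this
          exact tendsto_nhds_unique (hseq hY hs hx hxs) this
      · intro a b c d h
        obtain ⟨m, -, h1, h2⟩ := hκ h
        constructor <;> linarith
    obtain ⟨s, hs, t, ht, h⟩ := hne
    rcases le_total s t with hst | hst
    · have := hconst s t hs.1 hst ht.2
      exact h.elim (· this.1) (· this.2)
    · have := hconst t s ht.1 hst hs.2
      exact h.elim (· this.1.symm) (· this.2.symm)
  have hpos : 0 < κ * κ := mul_self_pos.2 hκ0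
  -- The slope of a neighbour chord is the mediant, which lies between the two Farey points;
  -- multiplying by `κ` turns the factor `m * κ` into the positive `m * (κ * κ)`.
  have hpair : ∀ {a b c d}, SternPair a b c d →
      0 < κ * (X (fareyPoint c d) - X (fareyPoint a b)) ∧
      fareyPoint a b * (κ * (X (fareyPoint c d) - X (fareyPoint a b))) ≤
        κ * (Y (fareyPoint c d) - Y (fareyPoint a b)) ∧
      κ * (Y (fareyPoint c d) - Y (fareyPoint a b)) ≤
        fareyPoint c d * (κ * (X (fareyPoint c d) - X (fareyPoint a b))) := by
    intro a b c d h
    obtain ⟨m, hm, h1, h2⟩ := hκ h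
    have p1 := h.pos_left
    have p2 := h.pos_right
    have hlt := h.fareyPoint_lt
    have hb : (b : ℝ) = fareyPoint a b * (a + b) := by unfold fareyPoint; field_simp
    have hd : (d : ℝ) = fareyPoint c d * (c + d) := by unfold fareyPoint; field_simp
    have hmk : 0 < m * (κ * κ) := by positivity
    rw [h1, h2]
    refine ⟨?_, ?_, ?_⟩
    · have : κ * (m * κ * (a + b + c + d)) = m * (κ * κ) * ((a + b) + (c + d)) := by ring
      rw [this]
      positivity
    · have e : κ * (m * κ * (b + d)) - fareyPoint a b * (κ * (m * κ * (a + b + c + d))) =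
          m * (κ * κ) * ((fareyPoint c d - fareyPoint a b) * (c + d)) := by
        linear_combination m * (κ * κ) * (hb + hd)
      have : 0 ≤ m * (κ * κ) * ((fareyPoint c d - fareyPoint a b) * (c + d)) :=
        mul_nonneg hmk.le (mul_nonneg (by linarith) (by linarith))
      linarith
    · have e : fareyPoint c d * (κ * (m * κ * (a + b + c + d))) - κ * (m * κ * (b + d)) =
          m * (κ * κ) * ((fareyPoint c d - fareyPoint a b) * (a + b)) := by
        linear_combination -m * (κ * κ) * (hb + hd)
      have : 0 ≤ m * (κ * κ) * ((fareyPoint c d - fareyPoint a b) * (a + b)) :=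
        mul_nonneg hmk.le (mul_nonneg (by linarith) (by linarith))
      linarith
  -- Slope bounds on adjacent intervals combine because the slope over the union is a weighted mean;
  -- the clause `s ≤ t` and the sign of the `X`-increment make the relation transitive. Only weak
  -- inequalities survive limits, so strictness is recovered afterwards from a neighbour pair inside
  -- `[s, t]`.
  have hR : ∀ s t, 0 ≤ s → s ≤ t → t ≤ 1 → s ≤ t ∧ 0 ≤ κ * (X t - X s) ∧
      s * (κ * (X t - X s)) ≤ κ * (Y t - Y s) ∧ κ * (Y t - Y s) ≤ t * (κ * (X t - X s)) := by
    intro s t h0 hst h1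
    refine rel_of_le (R := fun s t => s ≤ t ∧ 0 ≤ κ * (X t - X s) ∧
      s * (κ * (X t - X s)) ≤ κ * (Y t - Y s) ∧ κ * (Y t - Y s) ≤ t * (κ * (X t - X s)))
      (fun x => by simp) ?_ ?_ ?_ h0 hst h1
    · rintro x y z ⟨hxy, a1, a2, a3⟩ ⟨hyz, b1, b2, b3⟩
      have c1 := mul_le_mul_of_nonneg_right hxy b1
      have c2 := mul_le_mul_of_nonneg_right hyz a1
      exact ⟨hxy.trans hyz, by linarith, by linarith, by linarith⟩
    · intro x y s t hx hy hs ht hxs hyt hR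
      have tX := ((hseq hX ht hy hyt).sub (hseq hX hs hx hxs)).const_mul κ
      have tY := ((hseq hY ht hy hyt).sub (hseq hY hs hx hxs)).const_mul κ
      exact ⟨le_of_tendsto_of_tendsto' hxs hyt fun n => (hR n).1,
        ge_of_tendsto' tX fun n => (hR n).2.1,
        le_of_tendsto_of_tendsto' (hxs.mul tX) tY fun n => (hR n).2.2.1,
        le_of_tendsto_of_tendsto' tY (hyt.mul tX) fun n => (hR n).2.2.2⟩
    · intro a b c d h
      obtain ⟨h1, h2, h3⟩ := hpair h
      exact ⟨h.fareyPoint_lt.le, h1.le, h2, h3⟩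
  refine ⟨κ, hκ0, fun s t h0 hst h1 => ⟨?_, (hR s t h0 hst.le h1).2.2⟩⟩
  obtain ⟨a, b, c, d, h, hsa, hct⟩ := exists_between h0 hst h1
  have hm := h.fareyPoint_mem
  have hlt := h.fareyPoint_lt
  have k1 := (hR s _ h0 hsa (hlt.le.trans hm.2)).2.1
  have k2 := (hpair h).1
  have k3 := (hR _ t (hm.1.trans hlt.le) hct h1).2.1
  linarith

end SternPair

/-! ### From slopes to the plane: tangent lines and convexity. -/

/-- The cross product of two vectors of the plane. -/
noncomputable def cross (w z : ℂ) : ℝ := w.re * z.im - w.im * z.re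

/-- A nonconstant continuous plane curve all of whose chords over Stern–Brocot neighbours have the
direction of the mediant: the chord over `[s, t]` lies in the cone spanned by the directions at `s`
and `t`. -/
theorem exists_chord_cone {u v : ℂ} (huv : cross u v ≠ 0) {F : ℝ → ℂ}
    (hF : ContinuousOn F (Icc 0 1))
    (hchord : ∀ {a b c d}, SternPair a b c d → ∃ k : ℝ,
      F (fareyPoint c d) - F (fareyPoint a b) = k * ((a + c : ℕ) * u + (b + d : ℕ) * v))
    (hne : ∃ s ∈ Icc (0 : ℝ) 1, ∃ t ∈ Icc (0 : ℝ) 1, F s ≠ F t) :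
    ∃ (X Y : ℝ → ℝ) (κ : ℝ), (∀ t, F t = X t * u + Y t * (v - u)) ∧
      (∀ t, X t = cross (F t) (v - u) / cross u v) ∧ (∀ t, Y t = cross u (F t) / cross u v) ∧
      κ ≠ 0 ∧ ∀ s t, 0 ≤ s → s < t → t ≤ 1 → 0 < κ * (X t - X s) ∧
      s * (κ * (X t - X s)) ≤ κ * (Y t - Y s) ∧ κ * (Y t - Y s) ≤ t * (κ * (X t - X s)) := by
  -- Cramer's rule in the basis `u`, `v - u`, in which `a * u + b * v` has coordinates `(a + b, b)`
  -- and hence slope `fareyPoint a b`.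
  have hrep : ∀ z : ℂ, z = (cross z (v - u) / cross u v : ℝ) * u +
      (cross u z / cross u v : ℝ) * (v - u) := by
    intro z
    have h : u.re * v.im - u.im * v.re ≠ 0 := huv
    apply Complex.ext <;>
    · simp only [cross, Complex.add_re, Complex.add_im, Complex.sub_re, Complex.sub_im,
        Complex.re_ofReal_mul, Complex.im_ofReal_mul]
      rw [div_mul_eq_mul_div, div_mul_eq_mul_div, ← add_div, eq_div_iff h]
      ring
  set X : ℝ → ℝ := fun t => cross (F t) (v - u) / cross u v with hX
  set Y : ℝ → ℝ := fun t => cross u (F t) / cross u v with hY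
  have hre : ContinuousOn (fun t => (F t).re) (Icc 0 1) := Complex.continuous_re.comp_continuousOn hF
  have him : ContinuousOn (fun t => (F t).im) (Icc 0 1) := Complex.continuous_im.comp_continuousOn hF
  have hXc : ContinuousOn X (Icc 0 1) := by
    simp only [hX, cross]; fun_prop
  have hYc : ContinuousOn Y (Icc 0 1) := by
    simp only [hY, cross]; fun_prop
  obtain ⟨κ, hκ, H⟩ := SternPair.exists_slope_bounds hXc hYc (by
    intro a b c d h
    obtain ⟨k, hk⟩ := hchord h
    refine ⟨k, ?_⟩
    have h1 := congrArg Complex.re hk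
    have h2 := congrArg Complex.im hk
    simp only [Complex.add_re, Complex.add_im, Complex.sub_re, Complex.sub_im, Complex.natCast_re,
      Complex.natCast_im, Complex.mul_re, Complex.mul_im, Complex.ofReal_re, Complex.ofReal_im] at h1 h2
    push_cast at h1 h2
    simp only [hX, hY]
    rw [← sub_div, ← sub_div, div_eq_iff huv, div_eq_iff huv]
    simp only [cross, Complex.sub_re, Complex.sub_im]
    constructor
    · linear_combination (v.im - u.im) * h1 - (v.re - u.re) * h2
    · linear_combination u.re * h2 - u.im * h1) (by
    obtain ⟨s, hs, t, ht, hst⟩ := hne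
    refine ⟨s, hs, t, ht, ?_⟩
    by_contra! hc
    apply hst
    rw [hrep (F s), hrep (F t)]
    change ((X s : ℝ) : ℂ) * u + (Y s : ℝ) * (v - u) = (X t : ℝ) * u + (Y t : ℝ) * (v - u)
    rw [hc.1, hc.2])
  exact ⟨X, Y, κ, fun t => hrep (F t), fun _ => rfl, fun _ => rfl, hκ, H⟩

theorem abs_cross_le (w z : ℂ) : |cross w z| ≤ ‖w‖ * ‖z‖ := by
  have : cross w z = ((starRingEnd ℂ) w * z).im := by
    simp only [cross, Complex.mul_im, Complex.conj_re, Complex.conj_im]; ring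
  rw [this]
  refine (Complex.abs_im_le_norm _).trans_eq ?_
  rw [norm_mul, Complex.norm_conj]

theorem cross_smul_eq (a b z : ℂ) :
    (cross a b : ℂ) * z = (cross z b : ℂ) * a + (cross a z : ℂ) * b := by
  apply Complex.ext <;>
  · simp only [cross, Complex.add_re, Complex.add_im, Complex.re_ofReal_mul, Complex.im_ofReal_mul]
    ring

/-- The cross product with `a` does not change when `p` is replaced by another point of the line. -/
theorem AffineSubspace.abs_cross_le_infDist {L : AffineSubspace ℝ ℂ} {p a : ℂ} (hp : p ∈ L)
    (ha : L.direction = Submodule.span ℝ {a}) (q : ℂ) :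
    |cross a (q - p)| ≤ ‖a‖ * Metric.infDist q (L : Set ℂ) := by
  have hne : (L : Set ℂ).Nonempty := ⟨p, hp⟩
  rcases eq_or_ne a 0 with rfl | h0
  · simp [cross]
  have hpos : 0 < ‖a‖ := norm_pos_iff.2 h0
  rw [← div_le_iff₀' hpos, Metric.le_infDist hne]
  intro y hy
  rw [div_le_iff₀' hpos]
  have hyp : y - p ∈ L.direction := AffineSubspace.vsub_mem_direction hy hp
  rw [ha, Submodule.mem_span_singleton] at hyp
  obtain ⟨k, hk⟩ := hyp
  have : cross a (q - p) = cross a (q - y) := by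
    have hy' : y = p + k • a := by rw [hk]; ring
    rw [hy']
    simp only [cross, Complex.sub_re, Complex.sub_im, Complex.add_re, Complex.add_im,
      Complex.real_smul, Complex.re_ofReal_mul, Complex.im_ofReal_mul]
    ring
  rw [this, dist_eq_norm]
  exact abs_cross_le _ _

/-- A set has at most one tangent line at a point. -/
theorem IsTangentLine.unique {Γ : Set ℂ} {p : ℂ} {L L' : AffineSubspace ℝ ℂ}
    (h : IsTangentLine Γ p L) (h' : IsTangentLine Γ p L') : L = L' := by
  obtain ⟨hp, hr, -, hacc, ho⟩ := h
  obtain ⟨hp', hr', -, -, ho'⟩ := h'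
  have hspan : ∀ (M : Submodule ℝ ℂ), Module.finrank ℝ M = 1 →
      ∃ a : ℂ, a ≠ 0 ∧ M = Submodule.span ℝ {a} := by
    intro M hM
    obtain ⟨⟨a, haM⟩, ha, hspan⟩ := finrank_eq_one_iff'.1 hM
    refine ⟨a, fun h => ha (Subtype.ext h), le_antisymm ?_ ?_⟩
    · intro x hx
      obtain ⟨k, hk⟩ := hspan ⟨x, hx⟩
      exact Submodule.mem_span_singleton.2 ⟨k, congrArg Subtype.val hk⟩
    · rw [Submodule.span_singleton_le_iff_mem]; exact haM
  obtain ⟨a, ha, hL⟩ := hspan _ hr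
  obtain ⟨b, hb, hL'⟩ := hspan _ hr'
  by_cases hab : cross a b = 0
  · refine AffineSubspace.ext_of_direction_eq ?_ ⟨p, hp, hp'⟩
    have e : ∀ {a b : ℂ}, a ≠ 0 → cross a b = 0 → b ∈ Submodule.span ℝ {a} := by
      intro a b ha hab
      have hn : (Complex.normSq a : ℝ) ≠ 0 := (Complex.normSq_pos.2 ha).ne'
      refine Submodule.mem_span_singleton.2
        ⟨(a.re * b.re + a.im * b.im) / Complex.normSq a, ?_⟩
      rw [Complex.normSq_apply] at hn ⊢
      unfold cross at hab
      apply Complex.ext <;>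
        simp only [Complex.real_smul, Complex.re_ofReal_mul, Complex.im_ofReal_mul] <;>
        rw [div_mul_eq_mul_div, div_eq_iff hn]
      · linear_combination a.im * hab
      · linear_combination -a.re * hab
    rw [hL, hL']
    apply le_antisymm <;> rw [Submodule.span_singleton_le_iff_mem]
    · exact e hb (by unfold cross at hab ⊢; linarith)
    · exact e ha hab
  · exfalso
    -- For independent directions, `cross_smul_eq` expands `q - p` in `a` and `b`, with coefficients
    -- controlled by the distances to the two lines. If both distances were `o(|q - p|)`, so would
    -- be `q - p` itself.
    have hbound : (fun q : ℂ => q - p) =O[𝓝[Γ] p]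
        (fun q => Metric.infDist q (L : Set ℂ) + Metric.infDist q (L' : Set ℂ)) := by
      refine Asymptotics.IsBigO.of_bound (‖a‖ * ‖b‖ / |cross a b|) (Eventually.of_forall fun q => ?_)
      have h1 := AffineSubspace.abs_cross_le_infDist hp hL q
      have h2 := AffineSubspace.abs_cross_le_infDist hp' hL' q
      have hcpos : 0 < |cross a b| := abs_pos.2 hab
      rw [div_mul_eq_mul_div, le_div_iff₀ hcpos, Real.norm_of_nonneg
        (add_nonneg Metric.infDist_nonneg Metric.infDist_nonneg)]
      have h3 := congrArg norm (cross_smul_eq a b (q - p))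
      rw [norm_mul, Complex.norm_real, Real.norm_eq_abs] at h3
      have h4 := norm_add_le ((cross (q - p) b : ℂ) * a) ((cross a (q - p) : ℂ) * b)
      rw [norm_mul, norm_mul, Complex.norm_real, Complex.norm_real, Real.norm_eq_abs,
        Real.norm_eq_abs] at h4
      have h5 : |cross (q - p) b| = |cross b (q - p)| := by
        rw [← abs_neg]; congr 1; unfold cross; ring
      rw [h5] at h4
      nlinarith [norm_nonneg a, norm_nonneg b, mul_le_mul_of_nonneg_right h1 (norm_nonneg b),
        mul_le_mul_of_nonneg_right h2 (norm_nonneg a)]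
    refine Asymptotics.isLittleO_irrefl ?_ (hbound.trans_isLittleO (ho.add ho'))
    rw [frequently_nhdsWithin_iff]
    exact (accPt_iff_frequently.1 hacc).mono fun q hq => ⟨sub_ne_zero.2 hq.1, hq.2⟩

/-- A continuous injective curve on a compact set returns to a point only near its parameter. -/
theorem eventually_param_close {F : ℝ → ℂ} {K : Set ℝ} (hK : IsCompact K) (hF : ContinuousOn F K)
    (hinj : InjOn F K) {τ : ℝ} (hτ : τ ∈ K) {ε : ℝ} (hε : 0 < ε) :
    ∀ᶠ q in 𝓝 (F τ), ∀ t ∈ K, F t = q → |t - τ| < ε := by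
  have hS : IsCompact (K ∩ {t | ε ≤ |t - τ|}) :=
    hK.inter_right (isClosed_le continuous_const (by fun_prop))
  have hcl := (hS.image_of_continuousOn (hF.mono inter_subset_left)).isClosed
  have hmem : F τ ∉ F '' (K ∩ {t | ε ≤ |t - τ|}) := by
    rintro ⟨t, ⟨ht, htε⟩, heq⟩
    rw [hinj ht hτ heq] at htε
    simp only [mem_ofPred_eq, sub_self, abs_zero] at htε
    linarith
  filter_upwards [hcl.isOpen_compl.mem_nhds hmem] with q hq t ht htq
  by_contra! hcon
  exact hq ⟨t, ⟨ht, hcon⟩, htq⟩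

/-- A nonconstant continuous plane curve all of whose chords over Stern–Brocot neighbours have the
direction of the mediant is injective, has the expected tangent lines, and lies on one side of
each of them. -/
theorem tangent_and_convex_of_chords {u v : ℂ} (huv : cross u v ≠ 0) {F : ℝ → ℂ}
    (hF : ContinuousOn F (Icc 0 1))
    (hchord : ∀ {a b c d}, SternPair a b c d → ∃ k : ℝ,
      F (fareyPoint c d) - F (fareyPoint a b) = k * ((a + c : ℕ) * u + (b + d : ℕ) * v))
    (hne : ∃ s ∈ Icc (0 : ℝ) 1, ∃ t ∈ Icc (0 : ℝ) 1, F s ≠ F t) :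
    InjOn F (Icc 0 1) ∧ ∀ τ ∈ Icc (0 : ℝ) 1,
      IsTangentLine (F '' Icc 0 1) (F τ)
        (AffineSubspace.mk' (F τ) (Submodule.span ℝ {u + τ * (v - u)})) ∧
      ∃ n : ℂ, n ≠ 0 ∧ (∀ z ∈ Submodule.span ℝ {u + τ * (v - u)}, inner ℝ n z = 0) ∧
        ∀ z ∈ F '' Icc 0 1, 0 ≤ inner ℝ n (z - F τ) := by
  obtain ⟨X, Y, κ, hXY, hX, hY, hκ, H⟩ := exists_chord_cone huv hF hchord hne
  have hinj : InjOn F (Icc 0 1) := by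
    intro s hs t ht hst
    have hXst : X s = X t := by rw [hX, hX, hst]
    rcases lt_trichotomy s t with h | h | h
    · have := (H s t hs.1 h ht.2).1
      rw [hXst, sub_self, mul_zero] at this
      exact absurd this (lt_irrefl _)
    · exact h
    · have := (H t s ht.1 h hs.2).1
      rw [hXst, sub_self, mul_zero] at this
      exact absurd this (lt_irrefl _)
  refine ⟨hinj, fun τ hτ => ?_⟩
  set w : ℂ := u + τ * (v - u) with hw
  have hwuv : cross u w = τ * cross u v ∧ cross w v = (1 - τ) * cross u v := by
    simp only [hw, cross, Complex.add_re, Complex.add_im, Complex.sub_re, Complex.sub_im,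
      Complex.re_ofReal_mul, Complex.im_ofReal_mul]
    constructor <;> ring
  have hw0 : w ≠ 0 := by
    intro h
    rw [h] at hwuv
    have h1 : cross u 0 = 0 := by simp [cross]
    have h2 : cross 0 v = 0 := by simp [cross]
    apply huv
    linarith [hwuv.1, hwuv.2]
  -- The deviation from the line of slope `τ`: slopes of chords from `τ` lie between `τ` and `t`.
  -- The lower bound gives one-sidedness, the upper bound tangency.
  have hside : ∀ t ∈ Icc (0 : ℝ) 1, 0 ≤ κ * ((Y t - Y τ) - τ * (X t - X τ)) ∧
      κ * ((Y t - Y τ) - τ * (X t - X τ)) ≤ |t - τ| * (|κ| * |X t - X τ|) := by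
    intro t ht
    rw [← abs_mul]
    rcases lt_trichotomy t τ with h | rfl | h
    · obtain ⟨h1, h2, h3⟩ := H t τ ht.1 h hτ.2
      rw [abs_of_neg (sub_neg.2 h), abs_of_neg (show κ * (X t - X τ) < 0 by linarith)]
      constructor <;> nlinarith
    · simp
    · obtain ⟨h1, h2, h3⟩ := H τ t hτ.1 h ht.2
      rw [abs_of_pos (sub_pos.2 h), abs_of_pos h1]
      constructor <;> nlinarith
  refine ⟨⟨AffineSubspace.self_mem_mk' _ _, ?_, mem_image_of_mem F hτ, ?_, ?_⟩, ?_⟩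
  · rw [AffineSubspace.direction_mk']
    exact finrank_span_singleton hw0
  -- A connected set with more than one point has no isolated points.
  · refine (isPreconnected_Icc.image F hF).preperfect_of_nontrivial ?_ _ (mem_image_of_mem F hτ)
    obtain ⟨s, hs, t, ht, hst⟩ := hne
    exact ⟨_, mem_image_of_mem F hs, _, mem_image_of_mem F ht, hst⟩
  · rw [Asymptotics.isLittleO_iff]
    intro c hc
    set C : ℝ := ‖v - u‖ * ‖v - u‖ / |cross u v| with hC
    have hD : 0 < |cross u v| := abs_pos.2 huv
    have hC0 : 0 ≤ C := by positivity
    have hε : 0 < c / (C + 1) := by positivity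
    filter_upwards [nhdsWithin_le_nhds (eventually_param_close isCompact_Icc hF hinj hτ hε),
      self_mem_nhdsWithin] with q hq hqΓ
    obtain ⟨t, ht, rfl⟩ := hqΓ
    have htτ := hq t ht rfl
    rw [Real.norm_of_nonneg Metric.infDist_nonneg]
    -- Compare `F t` with the point of the line having the same `X`-coordinate; the difference is
    -- the deviation times `v - u`.
    have hmem : F τ + (X t - X τ : ℝ) * w ∈
        (AffineSubspace.mk' (F τ) (Submodule.span ℝ {w}) : Set ℂ) := by
      rw [SetLike.mem_coe, AffineSubspace.mem_mk', vsub_eq_sub, add_sub_cancel_left]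
      exact Submodule.mem_span_singleton.2 ⟨_, Complex.real_smul⟩
    refine (Metric.infDist_le_dist_of_mem hmem).trans ?_
    have hdist : F t - (F τ + (X t - X τ : ℝ) * w) =
        ((Y t - Y τ) - τ * (X t - X τ) : ℝ) * (v - u) := by
      rw [hXY t, hXY τ, hw]; push_cast; ring
    rw [dist_eq_norm, hdist, norm_mul, Complex.norm_real, Real.norm_eq_abs]
    have hs1 : |(Y t - Y τ) - τ * (X t - X τ)| ≤ |t - τ| * |X t - X τ| := by
      obtain ⟨h1, h2⟩ := hside t ht
      have hk : 0 < |κ| := abs_pos.2 hκ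
      refine le_of_mul_le_mul_left ?_ hk
      rw [← abs_mul, abs_of_nonneg h1]
      linarith
    have hs2 : |X t - X τ| ≤ ‖F t - F τ‖ * ‖v - u‖ / |cross u v| := by
      have : X t - X τ = cross (F t - F τ) (v - u) / cross u v := by
        rw [hX, hX, ← sub_div]
        congr 1
        simp only [cross, Complex.sub_re, Complex.sub_im]
        ring
      rw [this, abs_div]
      exact div_le_div_of_nonneg_right (abs_cross_le _ _) hD.le
    calc |(Y t - Y τ) - τ * (X t - X τ)| * ‖v - u‖
        ≤ (c / (C + 1) * (‖F t - F τ‖ * ‖v - u‖ / |cross u v|)) * ‖v - u‖ := by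
          refine mul_le_mul_of_nonneg_right (hs1.trans ?_) (norm_nonneg _)
          exact mul_le_mul htτ.le hs2 (abs_nonneg _) hε.le
      _ = c * (C / (C + 1)) * ‖F t - F τ‖ := by rw [hC]; ring
      _ ≤ c * 1 * ‖F t - F τ‖ := by
          refine mul_le_mul_of_nonneg_right (mul_le_mul_of_nonneg_left ?_ hc.le) (norm_nonneg _)
          rw [div_le_one (by linarith)]
          linarith
      _ = c * ‖F t - F τ‖ := by rw [mul_one]
  · have hinner : ∀ z : ℂ, inner ℝ ((κ / cross u v : ℝ) * (Complex.I * w)) z =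
        κ / cross u v * cross w z := by
      intro z
      simp only [Complex.inner, cross, map_mul, Complex.conj_ofReal, Complex.conj_I, Complex.mul_re,
        Complex.mul_im, Complex.ofReal_re, Complex.ofReal_im, Complex.neg_re, Complex.neg_im,
        Complex.I_re, Complex.I_im, Complex.conj_re, Complex.conj_im]
      ring
    -- The tangent direction turned by a right angle; the real factor fixes the side, accounting for
    -- the orientations of the curve and of the basis.
    refine ⟨(κ / cross u v : ℝ) * (Complex.I * w), ?_, ?_, ?_⟩
    · exact mul_ne_zero (Complex.ofReal_ne_zero.2 (div_ne_zero hκ huv))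
        (mul_ne_zero Complex.I_ne_zero hw0)
    · intro z hz
      obtain ⟨k, rfl⟩ := Submodule.mem_span_singleton.1 hz
      rw [hinner]
      simp only [cross, Complex.real_smul, Complex.re_ofReal_mul, Complex.im_ofReal_mul]
      ring
    · rintro _ ⟨t, ht, rfl⟩
      have e : cross w (F t - F τ) = cross u v * ((Y t - Y τ) - τ * (X t - X τ)) := by
        rw [hXY t, hXY τ, hw]
        simp only [cross, Complex.add_re, Complex.add_im, Complex.sub_re, Complex.sub_im,
          Complex.re_ofReal_mul, Complex.im_ofReal_mul]
        ring
      rw [hinner, e, ← mul_assoc, div_mul_cancel₀ _ huv]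
      exact (hside t ht).1

/-! ### Spinors of circles tangent to `C₀`: tangency and successors. -/

namespace GenCircle

/-- The positive factor between the square of a spinor of a circle and its vector. -/
noncomputable def spinorScale (r₀ : ℝ) : GenCircle → ℝ
  | circle _ r _ => r * r₀
  | line _ _ _ => r₀

/-- `u` is a spinor of the circle `C`, which is externally tangent to the circle of centre `c₀` and
radius `r₀`. -/
def HasSpinor (c₀ : ℂ) (r₀ : ℝ) (hr₀ : 0 < r₀) (C : GenCircle) (u : ℂ) : Prop :=
  (spinorScale r₀ C : ℂ) * u ^ 2 = C.vec c₀ ∧ (circle c₀ r₀ hr₀).ExtTangent C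

theorem spinorScale_pos {r₀ : ℝ} (hr₀ : 0 < r₀) (C : GenCircle) : 0 < spinorScale r₀ C := by
  cases C with
  | circle c r hr => exact mul_pos hr hr₀
  | line n d hn => exact hr₀

theorem ExtTangent.symm {C C' : GenCircle} (h : C.ExtTangent C') : C'.ExtTangent C := by
  cases C <;> cases C' <;> simp only [ExtTangent] at h ⊢
  · rw [dist_comm, h, add_comm]
  all_goals exact h

variable {c₀ : ℂ} {r₀ : ℝ} {hr₀ : 0 < r₀}

theorem exists_hasSpinor {C : GenCircle} (h : (circle c₀ r₀ hr₀).ExtTangent C) :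
    ∃ u, HasSpinor c₀ r₀ hr₀ C u := by
  have hs : (spinorScale r₀ C : ℂ) ≠ 0 := Complex.ofReal_ne_zero.2 (spinorScale_pos hr₀ C).ne'
  obtain ⟨u, hu⟩ := IsAlgClosed.exists_pow_nat_eq (C.vec c₀ / spinorScale r₀ C) two_pos
  exact ⟨u, by rw [hu, mul_div_cancel₀ _ hs], h⟩

theorem HasSpinor.normSq_eq {C : GenCircle} {u : ℂ} (h : HasSpinor c₀ r₀ hr₀ C u) :
    Complex.normSq u = C.curvature + 1 / r₀ := by
  obtain ⟨hu, ht⟩ := h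
  have hu' := congrArg norm hu
  rw [norm_mul, norm_pow, Complex.norm_of_nonneg (spinorScale_pos hr₀ C).le,
    ← Complex.normSq_eq_norm_sq] at hu'
  cases C with
  | circle c r hr =>
    simp only [ExtTangent, spinorScale, vec, curvature] at *
    rw [dist_comm, dist_eq_norm] at ht
    rw [ht] at hu'
    field_simp
    linarith
  | line n d hn =>
    simp only [spinorScale, vec, curvature] at *
    rw [hn] at hu'
    field_simp
    linarith

/-- The law of cosines with `1 - cos 2θ = 2 sin² θ`, where `θ` is the angle between the spinors. For
centres of circles the first square becomes `(r - r') ^ 2`, so tangency fixes the cross product. -/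
theorem normSq_mul_sq_sub (s s' : ℝ) (u u' : ℂ) :
    Complex.normSq (s * u ^ 2 - s' * u' ^ 2) =
      (s * Complex.normSq u - s' * Complex.normSq u') ^ 2 + 4 * s * s' * cross u u' ^ 2 := by
  simp only [cross, Complex.normSq_apply, Complex.sub_re, Complex.sub_im, sq,
    Complex.mul_re, Complex.mul_im, Complex.ofReal_re, Complex.ofReal_im]
  ring

theorem inner_mul_sq (s s' : ℝ) (u u' : ℂ) :
    inner ℝ ((s : ℂ) * u ^ 2) ((s' : ℂ) * u' ^ 2) =
      s * s' * (Complex.normSq u * Complex.normSq u' - 2 * cross u u' ^ 2) := by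
  simp only [cross, Complex.inner, Complex.normSq_apply, map_mul, Complex.conj_ofReal, sq,
    Complex.mul_re, Complex.mul_im, Complex.ofReal_re, Complex.ofReal_im, Complex.conj_re,
    Complex.conj_im]
  ring

theorem extTangent_line_circle_iff {n : ℂ} {d : ℝ} {hn : ‖n‖ = 1} {c : ℂ} {r : ℝ} {hr : 0 < r}
    {u u' : ℂ} (h : HasSpinor c₀ r₀ hr₀ (line n d hn) u)
    (h' : HasSpinor c₀ r₀ hr₀ (circle c r hr) u') :
    inner ℝ n c + r = d ↔ cross u u' ^ 2 = (1 / r₀) ^ 2 := by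
  have hN := h.normSq_eq
  have hN' := h'.normSq_eq
  obtain ⟨hu, ht⟩ := h
  obtain ⟨hu', -⟩ := h'
  simp only [ExtTangent, spinorScale, vec, curvature] at *
  have hi := inner_mul_sq r₀ (r * r₀) u u'
  rw [hu, hu', inner_sub_right, hN, hN'] at hi
  have e : inner ℝ n c + r - d = 2 * r * r₀ ^ 2 * ((1 / r₀) ^ 2 - cross u u' ^ 2) := by
    have : inner ℝ n c = inner ℝ n c₀ + (inner ℝ n c - inner ℝ n c₀) := by ring
    rw [this, hi, ← ht]
    field_simp
    ring
  have hpos : 2 * r * r₀ ^ 2 ≠ 0 := by positivity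
  constructor
  · intro hd
    rw [hd, sub_self, eq_comm, mul_eq_zero, or_iff_right hpos] at e
    linarith
  · intro hd
    rw [hd, sub_self, mul_zero] at e
    linarith

theorem extTangent_circle_circle_iff {c c' : ℂ} {r r' : ℝ} {hr : 0 < r} {hr' : 0 < r'} {u u' : ℂ}
    (h : HasSpinor c₀ r₀ hr₀ (circle c r hr) u) (h' : HasSpinor c₀ r₀ hr₀ (circle c' r' hr') u') :
    dist c c' = r + r' ↔ cross u u' ^ 2 = (1 / r₀) ^ 2 := by
  have hN := h.normSq_eq
  have hN' := h'.normSq_eq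
  obtain ⟨hu, -⟩ := h
  obtain ⟨hu', -⟩ := h'
  simp only [spinorScale, vec, curvature] at *
  have hi := normSq_mul_sq_sub (r * r₀) (r' * r₀) u u'
  rw [hu, hu', hN, hN', sub_sub_sub_cancel_right, Complex.normSq_eq_norm_sq, ← dist_eq_norm] at hi
  have e : dist c c' ^ 2 - (r + r') ^ 2 = 4 * r * r' * r₀ ^ 2 * (cross u u' ^ 2 - (1 / r₀) ^ 2) := by
    rw [hi]
    field_simp
    ring
  have hpos : 4 * r * r' * r₀ ^ 2 ≠ 0 := by positivity
  rw [← sq_eq_sq₀ dist_nonneg (by positivity), ← sub_eq_zero, e, mul_eq_zero, or_iff_right hpos,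
    sub_eq_zero]

theorem cross_sq_comm (u v : ℂ) : cross u v ^ 2 = cross v u ^ 2 := by unfold cross; ring

/-- Tangent circles have spinors of cross product `± 1 / r₀`. -/
theorem ExtTangent.cross_sq {C C' : GenCircle} {u u' : ℂ} (ht : C.ExtTangent C')
    (h : HasSpinor c₀ r₀ hr₀ C u) (h' : HasSpinor c₀ r₀ hr₀ C' u') :
    cross u u' ^ 2 = (1 / r₀) ^ 2 := by
  cases C <;> cases C'
  · exact (extTangent_circle_circle_iff h h').1 ht
  · rw [cross_sq_comm]; exact (extTangent_line_circle_iff h' h).1 ht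
  · exact (extTangent_line_circle_iff h h').1 ht
  · exact ht.elim

/-- Positive curvature rules out two parallel lines on opposite sides of `C₀`: their spinors meet
the cross product condition, but they do not count as tangent. -/
theorem extTangent_of_cross_sq {C C' : GenCircle} {u u' : ℂ} (hC : 0 < C.curvature)
    (h : HasSpinor c₀ r₀ hr₀ C u) (h' : HasSpinor c₀ r₀ hr₀ C' u')
    (hc : cross u u' ^ 2 = (1 / r₀) ^ 2) : C.ExtTangent C' := by
  cases C <;> cases C'
  · exact (extTangent_circle_circle_iff h h').2 hc
  · rw [cross_sq_comm] at hc; exact (extTangent_line_circle_iff h' h).2 hc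
  all_goals exact absurd hC (lt_irrefl _)

theorem curvature_nonneg (C : GenCircle) : 0 ≤ C.curvature := by
  cases C with
  | circle c r hr => exact (one_div_pos.2 hr).le
  | line n d hn => exact le_rfl

/-- Every vector that is long enough is a spinor of a circle of positive radius. -/
theorem exists_of_normSq {u : ℂ} (hu : 1 / r₀ < Complex.normSq u) :
    ∃ S : GenCircle, 0 < S.curvature ∧ HasSpinor c₀ r₀ hr₀ S u := by
  have hk : 0 < Complex.normSq u - 1 / r₀ := sub_pos.2 hu
  set r : ℝ := 1 / (Complex.normSq u - 1 / r₀) with hr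
  have hr0 : 0 < r := one_div_pos.2 hk
  refine ⟨circle (c₀ + (r * r₀ : ℝ) * u ^ 2) r hr0, one_div_pos.2 hr0, ?_, ?_⟩
  · simp only [spinorScale, vec, add_sub_cancel_left]
  · simp only [ExtTangent]
    rw [dist_self_add_right, norm_mul, norm_pow, Complex.norm_of_nonneg (by positivity),
      ← Complex.normSq_eq_norm_sq]
    have : Complex.normSq u = 1 / r + 1 / r₀ := by rw [hr, one_div_one_div]; ring
    rw [this]
    field_simp

theorem normSq_add_eq (u u' : ℂ) : Complex.normSq (u + u') =
    Complex.normSq u + Complex.normSq u' + 2 * inner ℝ u u' := by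
  simp only [Complex.inner, Complex.normSq_apply, Complex.add_re, Complex.add_im, Complex.mul_re,
    Complex.conj_re, Complex.conj_im]
  ring

/-- The sum of two spinors at a nonobtuse angle is a spinor of the successor. -/
theorem exists_isSuccessor {C C' : GenCircle} {u u' : ℂ} (h : HasSpinor c₀ r₀ hr₀ C u)
    (h' : HasSpinor c₀ r₀ hr₀ C' u') (ht : C.ExtTangent C') (hdot : 0 ≤ inner ℝ u u') :
    ∃ S : GenCircle, HasSpinor c₀ r₀ hr₀ S (u + u') ∧
      IsSuccessor (circle c₀ r₀ hr₀) C C' S ∧ S.ExtTangent C ∧ S.ExtTangent C' := by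
  have hN := h.normSq_eq
  have hN' := h'.normSq_eq
  have hadd := normSq_add_eq u u'
  have hc := ht.cross_sq h h'
  have hr : 0 < 1 / r₀ := one_div_pos.2 hr₀
  obtain ⟨S, hS, hSu⟩ := exists_of_normSq (c₀ := c₀) (hr₀ := hr₀) (u := u + u')
    (by linarith [C.curvature_nonneg, C'.curvature_nonneg])
  have t1 : S.ExtTangent C := by
    refine extTangent_of_cross_sq hS hSu h ?_
    rw [← hc]; simp only [cross, Complex.add_re, Complex.add_im]; ring
  have t2 : S.ExtTangent C' := by
    refine extTangent_of_cross_sq hS hSu h' ?_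
    rw [← hc]; simp only [cross, Complex.add_re, Complex.add_im]; ring
  refine ⟨S, hSu, ⟨⟨hSu.2.symm, t1, t2⟩, ?_⟩, t1, t2⟩
  intro T hT0 hT hT'
  obtain ⟨w, hw⟩ := exists_hasSpinor hT0.symm
  have hA := hT.cross_sq hw h
  have hB := hT'.cross_sq hw h'
  have e1 := hw.normSq_eq
  have e2 := hSu.normSq_eq
  -- A circle tangent to all three has a spinor `w = ± u ± u'`; this is the squared norm of the
  -- expansion of `w` in `u`, `u'`. Since `inner ℝ u u' ≥ 0`, equal signs give the larger curvature.
  have key : cross u u' ^ 2 * Complex.normSq w = cross w u' ^ 2 * Complex.normSq u +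
      cross w u ^ 2 * Complex.normSq u' - 2 * (cross w u * cross w u') * inner ℝ u u' := by
    simp only [cross, Complex.inner, Complex.normSq_apply, Complex.mul_re, Complex.conj_re,
      Complex.conj_im]
    ring
  have hAB : -(cross w u * cross w u') ≤ (1 / r₀) ^ 2 := by
    nlinarith [sq_nonneg (cross w u + cross w u')]
  rw [hA, hB, hc] at key
  have hle : (1 / r₀) ^ 2 * Complex.normSq w ≤ (1 / r₀) ^ 2 * Complex.normSq (u + u') := by
    rw [key, hadd]
    nlinarith [mul_le_mul_of_nonneg_right hAB hdot]
  have := le_of_mul_le_mul_left hle (by positivity)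
  linarith

/-- The circles of the family at neighbouring places of the Stern–Brocot tree. -/
theorem exists_family_of_sternPair {C₁ C₂ : GenCircle} {u v : ℂ} (hu : HasSpinor c₀ r₀ hr₀ C₁ u)
    (hv : HasSpinor c₀ r₀ hr₀ C₂ v) (ht : C₁.ExtTangent C₂) (hdot : 0 ≤ inner ℝ u v)
    {a b c d : ℕ} (h : SternPair a b c d) :
    ∃ C C' S : GenCircle, Family (circle c₀ r₀ hr₀) C₁ C₂ C ∧ Family (circle c₀ r₀ hr₀) C₁ C₂ C' ∧
      HasSpinor c₀ r₀ hr₀ C (a * u + b * v) ∧ HasSpinor c₀ r₀ hr₀ C' (c * u + d * v) ∧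
      HasSpinor c₀ r₀ hr₀ S ((a + c : ℕ) * u + (b + d : ℕ) * v) ∧ C.ExtTangent C' ∧
      IsSuccessor (circle c₀ r₀ hr₀) C C' S ∧ S.ExtTangent C ∧ S.ExtTangent C' := by
  -- Nonnegative combinations keep a nonobtuse angle, so the successor is always the sum and never
  -- the difference.
  have hdots : ∀ a b c d : ℕ, 0 ≤ inner ℝ ((a : ℂ) * u + b * v) ((c : ℂ) * u + d * v) := by
    intro a b c d
    have : inner ℝ ((a : ℂ) * u + b * v) ((c : ℂ) * u + d * v) =
        a * c * Complex.normSq u + b * d * Complex.normSq v + (a * d + b * c) * inner ℝ u v := by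
      simp only [Complex.inner, Complex.normSq_apply, Complex.mul_re, Complex.mul_im,
        Complex.conj_re, Complex.conj_im, Complex.add_re, Complex.add_im, Complex.natCast_re,
        Complex.natCast_im]
      ring
    rw [this]
    have := Complex.normSq_nonneg u
    have := Complex.normSq_nonneg v
    positivity
  have step : ∀ {a b c d : ℕ} {C C' : GenCircle}, Family (circle c₀ r₀ hr₀) C₁ C₂ C →
      Family (circle c₀ r₀ hr₀) C₁ C₂ C' → HasSpinor c₀ r₀ hr₀ C (a * u + b * v) →
      HasSpinor c₀ r₀ hr₀ C' (c * u + d * v) → C.ExtTangent C' →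
      ∃ C C' S : GenCircle, Family (circle c₀ r₀ hr₀) C₁ C₂ C ∧
        Family (circle c₀ r₀ hr₀) C₁ C₂ C' ∧
        HasSpinor c₀ r₀ hr₀ C (a * u + b * v) ∧ HasSpinor c₀ r₀ hr₀ C' (c * u + d * v) ∧
        HasSpinor c₀ r₀ hr₀ S ((a + c : ℕ) * u + (b + d : ℕ) * v) ∧ C.ExtTangent C' ∧
        IsSuccessor (circle c₀ r₀ hr₀) C C' S ∧ S.ExtTangent C ∧ S.ExtTangent C' := by
    intro a b c d C C' hC hC' hs hs' ht
    obtain ⟨S, hS, h1, h2, h3⟩ := exists_isSuccessor hs hs' ht (hdots a b c d)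
    refine ⟨C, C', S, hC, hC', hs, hs', ?_, ht, h1, h2, h3⟩
    convert hS using 1
    push_cast
    ring
  induction h with
  | base => exact step .left .right (by simpa using hu) (by simpa using hv) ht
  | left h ih =>
    obtain ⟨C, C', S, hC, hC', hs, hs', hS, ht, h1, h2, h3⟩ := ih
    exact step hC (.succ C C' S hC hC' ht h1) hs hS h2.symm
  | right h ih =>
    obtain ⟨C, C', S, hC, hC', hs, hs', hS, ht, h1, h2, h3⟩ := ih
    exact step (.succ C C' S hC hC' ht h1) hC' hS hs' h3

end GenCircle

/-! ### Angles of circles and directions of spinors. -/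

namespace GenCircle

variable {c₀ : ℂ} {r₀ : ℝ} {hr₀ : 0 < r₀}

/-- Of the two opposite spinors, the one at angle `a / 2` is needed: when two angles differ by less
than `π`, the chosen spinors form an acute angle. -/
theorem exists_hasSpinor_of_isAngleOf {C : GenCircle} {a : ℝ}
    (h : (circle c₀ r₀ hr₀).ExtTangent C) (ha : IsAngleOf a (C.vec c₀)) :
    ∃ r : ℝ, 0 < r ∧ HasSpinor c₀ r₀ hr₀ C (r * Complex.exp ((a / 2 : ℝ) * Complex.I)) := by
  have hs := spinorScale_pos hr₀ C
  have hv : 0 < ‖C.vec c₀‖ := norm_pos_iff.2 ha.1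
  refine ⟨√(‖C.vec c₀‖ / spinorScale r₀ C), Real.sqrt_pos.2 (by positivity), ?_, h⟩
  rw [mul_pow, ← Complex.ofReal_pow, Real.sq_sqrt (by positivity), ← Complex.exp_nat_mul, ← mul_assoc,
    ← Complex.ofReal_mul, mul_div_cancel₀ _ hs.ne']
  conv_rhs => rw [ha.2]
  congr 2
  push_cast
  ring

theorem HasSpinor.isAngleOf {C : GenCircle} {u : ℂ} {m t : ℝ} (h : HasSpinor c₀ r₀ hr₀ C u)
    (hm : 0 < m) (hu : u = m * Complex.exp ((t / 2 : ℝ) * Complex.I)) :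
    IsAngleOf t (C.vec c₀) := by
  have hs := spinorScale_pos hr₀ C
  have hpos : 0 < spinorScale r₀ C * m ^ 2 := by positivity
  have e : C.vec c₀ = (spinorScale r₀ C * m ^ 2 : ℝ) * Complex.exp ((t : ℂ) * Complex.I) := by
    rw [← h.1, hu, mul_pow, ← Complex.exp_nat_mul]
    push_cast
    rw [← mul_assoc]
    congr 2
    ring
  have hn : ‖C.vec c₀‖ = spinorScale r₀ C * m ^ 2 := by
    rw [e, norm_mul, Complex.norm_exp_ofReal_mul_I, mul_one, Complex.norm_of_nonneg hpos.le]
  refine ⟨norm_pos_iff.1 (hn ▸ hpos), ?_⟩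
  rw [hn, e]

theorem HasSpinor.sqrtLine_le {C : GenCircle} {u : ℂ} (h : HasSpinor c₀ r₀ hr₀ C u) :
    sqrtLine (C.vec c₀) ≤ Submodule.span ℝ {u} := by
  refine Submodule.span_le.2 fun w hw => ?_
  have hs := spinorScale_pos hr₀ C
  have e : w ^ 2 = ((√(spinorScale r₀ C) : ℝ) * u) ^ 2 := by
    rw [mul_pow, ← Complex.ofReal_pow, Real.sq_sqrt hs.le, h.1]
    exact hw
  refine Submodule.mem_span_singleton.2 ?_
  rcases sq_eq_sq_iff_eq_or_eq_neg.1 e with rfl | rfl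
  · exact ⟨√(spinorScale r₀ C), Complex.real_smul⟩
  · exact ⟨-√(spinorScale r₀ C), by rw [Complex.real_smul]; push_cast; ring⟩

end GenCircle

/-- The angles of the vectors on a segment between two vectors at an acute angle. -/
theorem exists_angle_param {a₁ a₂ r₁ r₂ : ℝ} (hr₁ : 0 < r₁) (hr₂ : 0 < r₂)
    (ha : |a₁ - a₂| < Real.pi) {u v : ℂ} (hu : u = r₁ * Complex.exp ((a₁ / 2 : ℝ) * Complex.I))
    (hv : v = r₂ * Complex.exp ((a₂ / 2 : ℝ) * Complex.I)) :
    ∃ ψ : ℝ → ℝ, ContinuousOn ψ (Icc 0 1) ∧ MapsTo ψ (Icc 0 1) (uIcc a₁ a₂) ∧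
      SurjOn ψ (Icc 0 1) (uIcc a₁ a₂) ∧ ∀ τ ∈ Icc (0 : ℝ) 1, ∃ m : ℝ, 0 < m ∧
        u + τ * (v - u) = m * Complex.exp ((ψ τ / 2 : ℝ) * Complex.I) := by
  obtain ⟨ha1, ha2⟩ := abs_lt.1 ha
  set δ : ℝ := (a₂ - a₁) / 2 with hδ
  have hcos : 0 < Real.cos δ := Real.cos_pos_of_mem_Ioo ⟨by linarith, by linarith⟩
  -- After rotation by `-a₁ / 2`, the point `u + τ * (v - u)` is `r₁` times `(1 - τ + τ * k) + τ * k
  -- * tan δ * I`. Hence `x τ` below is the tangent of its argument.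
  set k : ℝ := r₂ / r₁ * Real.cos δ with hk
  have hkpos : 0 < k := by positivity
  have hden : ∀ τ ∈ Icc (0 : ℝ) 1, 0 < 1 - τ + τ * k := by
    rintro τ ⟨h0, h1⟩
    rcases h0.eq_or_lt with rfl | h0
    · norm_num
    · have := mul_pos h0 hkpos
      linarith
  set x : ℝ → ℝ := fun τ => Real.tan δ * (τ * k / (1 - τ + τ * k)) with hx
  have hxc : ContinuousOn x (Icc 0 1) :=
    continuousOn_const.mul (ContinuousOn.div (by fun_prop) (by fun_prop) fun τ hτ => (hden τ hτ).ne')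
  have hψc : ContinuousOn (fun τ => a₁ + 2 * Real.arctan (x τ)) (Icc 0 1) :=
    continuousOn_const.add (continuousOn_const.mul (Real.continuous_arctan.comp_continuousOn hxc))
  have htan : Real.arctan (Real.tan δ) = δ := Real.arctan_tan (by linarith) (by linarith)
  have hψ0 : a₁ + 2 * Real.arctan (x 0) = a₁ := by simp [hx]
  have hψ1 : a₁ + 2 * Real.arctan (x 1) = a₂ := by
    have : x 1 = Real.tan δ := by
      simp only [hx]
      rw [sub_self, zero_add, one_mul, div_self hkpos.ne', mul_one]
    rw [this, htan, hδ]
    ring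
  refine ⟨fun τ => a₁ + 2 * Real.arctan (x τ), hψc, ?_, ?_, ?_⟩
  · intro τ hτ
    have hs0 : 0 ≤ τ * k / (1 - τ + τ * k) :=
      div_nonneg (mul_nonneg hτ.1 hkpos.le) (hden τ hτ).le
    have hs1 : τ * k / (1 - τ + τ * k) ≤ 1 := by
      rw [div_le_one (hden τ hτ)]
      linarith [hτ.2]
    rw [mem_uIcc]
    have hmono := Real.arctan_strictMono.monotone
    rcases le_total 0 (Real.tan δ) with h | h
    · left
      have h1 := hmono (show 0 ≤ x τ from mul_nonneg h hs0)
      have h2 := hmono (show x τ ≤ Real.tan δ from mul_le_of_le_one_right h hs1)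
      rw [Real.arctan_zero] at h1
      rw [htan] at h2
      constructor <;> simp only <;> linarith
    · right
      have h1 := hmono (show x τ ≤ 0 from mul_nonpos_of_nonpos_of_nonneg h hs0)
      have h2 := hmono (show Real.tan δ ≤ x τ by simp only [hx]; nlinarith)
      rw [Real.arctan_zero] at h1
      rw [htan] at h2
      constructor <;> simp only <;> linarith
  · have := intermediate_value_uIcc (a := (0 : ℝ)) (b := 1)
      (f := fun τ => a₁ + 2 * Real.arctan (x τ)) (by rwa [uIcc_of_le zero_le_one])
    rw [uIcc_of_le (zero_le_one : (0 : ℝ) ≤ 1)] at this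
    simp only [hψ0, hψ1] at this
    exact this
  · intro τ hτ
    have hD := hden τ hτ
    have hsq : 0 < √(1 + x τ ^ 2) := Real.sqrt_pos.2 (by positivity)
    refine ⟨r₁ * (1 - τ + τ * k) * √(1 + x τ ^ 2), by positivity, ?_⟩
    have hv' : v = Complex.exp ((a₁ / 2 : ℝ) * Complex.I) * (r₂ * Complex.exp ((δ : ℂ) * Complex.I)) := by
      rw [hv, mul_left_comm, ← Complex.exp_add]
      congr 2
      rw [hδ]
      push_cast
      ring
    have hexp : Complex.exp (((a₁ + 2 * Real.arctan (x τ)) / 2 : ℝ) * Complex.I) =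
        Complex.exp ((a₁ / 2 : ℝ) * Complex.I) *
          Complex.exp ((Real.arctan (x τ) : ℝ) * Complex.I) := by
      rw [← Complex.exp_add]
      congr 1
      push_cast
      ring
    have harc : Complex.exp ((Real.arctan (x τ) : ℝ) * Complex.I) * √(1 + x τ ^ 2) =
        1 + x τ * Complex.I := by
      rw [Complex.exp_mul_I, ← Complex.ofReal_cos, ← Complex.ofReal_sin, Real.cos_arctan,
        Real.sin_arctan]
      have : ((√(1 + x τ ^ 2) : ℝ) : ℂ) ≠ 0 := Complex.ofReal_ne_zero.2 hsq.ne'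
      push_cast
      field_simp
    have hδexp : (r₂ : ℂ) * Complex.exp ((δ : ℂ) * Complex.I) =
        (r₁ * k : ℝ) + (r₁ * k * Real.tan δ : ℝ) * Complex.I := by
      have e1 : r₁ * k = r₂ * Real.cos δ := by rw [hk]; field_simp
      have e2 : r₁ * k * Real.tan δ = r₂ * Real.sin δ := by
        rw [e1, mul_assoc, mul_comm (Real.cos δ), Real.tan_mul_cos hcos.ne']
      rw [e2, e1, Complex.exp_mul_I, ← Complex.ofReal_cos, ← Complex.ofReal_sin]
      push_cast
      ring
    have hxD : (x τ : ℂ) * ((1 - τ + τ * k : ℝ) : ℂ) = (Real.tan δ * (τ * k) : ℝ) := by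
      rw [← Complex.ofReal_mul]
      congr 1
      simp only [hx]
      rw [mul_assoc, div_mul_cancel₀ _ hD.ne']
    rw [hδexp] at hv'
    rw [hexp, hu, hv']
    generalize Complex.exp ((Real.arctan (x τ) : ℝ) * Complex.I) = E at harc ⊢
    push_cast at hxD ⊢
    linear_combination (-(r₁ : ℂ) * (1 - τ + τ * k) * Complex.exp (a₁ / 2 * Complex.I)) * harc -
      (r₁ : ℂ) * Complex.exp (a₁ / 2 * Complex.I) * Complex.I * hxD

/-! ### Assembly: reparametrisation of the Apollonian curve by the segment. -/

theorem theorem5p3 (c₀ : ℂ) (r₀ : ℝ) (hr₀ : 0 < r₀) (C₁ C₂ : GenCircle)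
    (h₀₁ : (GenCircle.circle c₀ r₀ hr₀).ExtTangent C₁)
    (h₀₂ : (GenCircle.circle c₀ r₀ hr₀).ExtTangent C₂)
    (h₁₂ : C₁.ExtTangent C₂)
    (a₁ a₂ : ℝ) (ha₁ : IsAngleOf a₁ (C₁.vec c₀)) (ha₂ : IsAngleOf a₂ (C₂.vec c₀))
    (ha : |a₁ - a₂| < Real.pi)
    (γ : ℝ → ℂ) (hγ : IsApollonianCurve c₀ r₀ hr₀ C₁ C₂ a₁ a₂ γ)
    (hne : ∃ t ∈ Set.uIcc a₁ a₂, ∃ t' ∈ Set.uIcc a₁ a₂, γ t ≠ γ t') :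
    (∀ t ∈ Set.uIcc a₁ a₂,
      IsTangentLine (γ '' Set.uIcc a₁ a₂) (γ t) (lineAtAngle (γ t) (t / 2)) ∧
      ∀ L : AffineSubspace ℝ ℂ, IsTangentLine (γ '' Set.uIcc a₁ a₂) (γ t) L →
        L = lineAtAngle (γ t) (t / 2)) ∧
    IsConvexCurve γ (Set.uIcc a₁ a₂) := by
  obtain ⟨r₁, hr₁, hu⟩ := GenCircle.exists_hasSpinor_of_isAngleOf h₀₁ ha₁
  obtain ⟨r₂, hr₂, hv⟩ := GenCircle.exists_hasSpinor_of_isAngleOf h₀₂ ha₂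
  set u : ℂ := r₁ * Complex.exp ((a₁ / 2 : ℝ) * Complex.I) with hu_def
  set v : ℂ := r₂ * Complex.exp ((a₂ / 2 : ℝ) * Complex.I) with hv_def
  have huv : cross u v ≠ 0 := by
    intro h
    have := h₁₂.cross_sq hu hv
    rw [h] at this
    have : 0 < (1 / r₀) ^ 2 := by positivity
    linarith
  have hdot : 0 ≤ inner ℝ u v := by
    have e : inner ℝ u v = r₁ * r₂ * Real.cos (a₂ / 2 - a₁ / 2) := by
      rw [Real.cos_sub, hu_def, hv_def, Complex.exp_mul_I, Complex.exp_mul_I, ← Complex.ofReal_cos,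
        ← Complex.ofReal_sin, ← Complex.ofReal_cos, ← Complex.ofReal_sin]
      simp only [Complex.inner, Complex.mul_re, Complex.mul_im, Complex.conj_re, Complex.conj_im,
        Complex.add_re, Complex.add_im, Complex.ofReal_re, Complex.ofReal_im, Complex.I_re,
        Complex.I_im]
      ring
    obtain ⟨h1, h2⟩ := abs_lt.1 ha
    rw [e]
    exact mul_nonneg (by positivity) (Real.cos_nonneg_of_mem_Icc ⟨by linarith, by linarith⟩)
  obtain ⟨ψ, hψc, hψm, hψs, hψ⟩ := exists_angle_param hr₁ hr₂ ha hu_def hv_def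
  have himage : (γ ∘ ψ) '' Icc 0 1 = γ '' uIcc a₁ a₂ := by
    rw [image_comp, hψs.image_eq_of_mapsTo hψm]
  -- `a * u + b * v` is `a + b` times the point of the segment with parameter `fareyPoint a b`, so
  -- the circle has the angle that `ψ` assigns to it.
  have hangle : ∀ {C : GenCircle} {a b : ℕ}, GenCircle.HasSpinor c₀ r₀ hr₀ C (a * u + b * v) →
      1 ≤ (a : ℝ) + b → fareyPoint a b ∈ Icc (0 : ℝ) 1 →
      IsAngleOf (ψ (fareyPoint a b)) (C.vec c₀) := by
    intro C a b hs hab hmem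
    obtain ⟨m, hm, hmψ⟩ := hψ _ hmem
    refine hs.isAngleOf (m := ((a : ℝ) + b) * m) (by positivity) ?_
    have hb : ((a : ℂ) + b) * (fareyPoint a b : ℝ) = b := by
      have : ((a : ℝ) + b) * fareyPoint a b = b := by unfold fareyPoint; field_simp
      exact_mod_cast congrArg (fun y : ℝ => (y : ℂ)) this
    rw [Complex.ofReal_mul, mul_assoc, ← hmψ]
    push_cast
    linear_combination (u - v) * hb
  obtain ⟨hinj, H⟩ := tangent_and_convex_of_chords huv (hγ.continuousOn.comp hψc hψm) (by
    intro a b c d h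
    obtain ⟨C, C', S, hC, hC', hs, hs', hS, ht, hsucc, -, -⟩ :=
      GenCircle.exists_family_of_sternPair hu hv h₁₂ hdot h
    have hm := h.fareyPoint_mem
    have hlt := h.fareyPoint_lt.le
    have hab : fareyPoint a b ∈ Icc (0 : ℝ) 1 := ⟨hm.1, hlt.trans hm.2⟩
    have hcd : fareyPoint c d ∈ Icc (0 : ℝ) 1 := ⟨hm.1.trans hlt, hm.2⟩
    have hmem := hS.sqrtLine_le (hγ.sub_mem C C' S hC hC' ht hsucc _ (hψm hab) _ (hψm hcd)
      (hangle hs h.pos_left hab) (hangle hs' h.pos_right hcd))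
    obtain ⟨k, hk⟩ := Submodule.mem_span_singleton.1 hmem
    -- The defining condition subtracts the right end from the left one, hence the sign.
    refine ⟨-k, ?_⟩
    rw [Complex.real_smul] at hk
    simp only [Function.comp_apply]
    rw [Complex.ofReal_neg, neg_mul, hk, neg_sub]) (by
    obtain ⟨t, ht, t', ht', hne⟩ := hne
    obtain ⟨s, hs, rfl⟩ := hψs ht
    obtain ⟨s', hs', rfl⟩ := hψs ht'
    exact ⟨s, hs, s', hs', hne⟩)
  rw [himage] at H
  have hspan : ∀ τ ∈ Icc (0 : ℝ) 1, Submodule.span ℝ {u + τ * (v - u)} =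
      Submodule.span ℝ {Complex.exp ((ψ τ / 2 : ℝ) * Complex.I)} := by
    intro τ hτ
    obtain ⟨m, hm, e⟩ := hψ τ hτ
    rw [e, ← Complex.real_smul]
    exact Submodule.span_singleton_smul_eq (IsUnit.mk0 m hm.ne') _
  have htangent : ∀ t ∈ uIcc a₁ a₂,
      IsTangentLine (γ '' uIcc a₁ a₂) (γ t) (lineAtAngle (γ t) (t / 2)) := by
    intro t ht
    obtain ⟨τ, hτ, rfl⟩ := hψs ht
    have := (H τ hτ).1
    rw [hspan τ hτ] at this
    exact this
  refine ⟨fun t ht => ⟨htangent t ht, fun L hL => hL.unique (htangent t ht)⟩, hγ.continuousOn, ?_,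
    fun t ht => ⟨⟨_, htangent t ht⟩, fun L hL => ?_⟩⟩
  · intro t ht t' ht' heq
    obtain ⟨s, hs, rfl⟩ := hψs ht
    obtain ⟨s', hs', rfl⟩ := hψs ht'
    rw [hinj hs hs' heq]
  · rw [hL.unique (htangent t ht)]
    obtain ⟨τ, hτ, rfl⟩ := hψs ht
    obtain ⟨n, hn, h1, h2⟩ := (H τ hτ).2
    refine ⟨n, hn, fun z hz => h1 _ ?_, h2⟩
    rw [hspan τ hτ]
    exact AffineSubspace.mem_mk'.1 hz
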